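/- Consider a turn-based two-player stochastic Rabin(1) game: finite sets $S$ of states and $A$ of actions, a partition of $S$ into controller and environment states, sets $A(s)\subseteq A$ of available actions, transition probabilities $P(s,a,s')\ge 0$ with $\sum_{s'}P(s,a,s')=1$ if $a\in A(s)$ and $=0$ otherwise, an initial state, and an accepting pair $(C,B)$ of subsets of $S$ (for instance, the product of a labeled game with a deterministic Rabin automaton having one accepting pair). Let $\gamma_B,\gamma_C$ be functions of $\gamma\in(0,1)$ with $0<\gamma_C(\gamma)<\gamma_B(\gamma)<\gamma$ for all $\gamma\in(0,1)$ and $$\lim_{\gamma\to1^-}\gamma_B(\gamma)=\lim_{\gamma\to1^-}\gamma_C(\gamma)=1,\qquad \lim_{\gamma\to1^-}\frac{1-\gamma}{1-\gamma_B(\gamma)}=\lim_{\gamma\to1^-}\frac{1-\gamma_B(\gamma)}{1-\gamma_C(\gamma)}=0.$$ Put $R_B(s)=1-\gamma_B$ if $s\in B$ and $R_B(s)=0$ otherwise; $\Gamma_{B,C}(s)=\gamma_C$ if $s\in C$, $\gamma_B$ if $s\in B\setminus C$, and $\gamma$ if $s\in S\setminus(B\cup C)$. The return of a path $\sigma\in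 S^{\mathbb N}$ from time $t$ is $$G_t(\sigma)=\sum_{i=0}^\infty R_B(\sigma[t+i])\prod_{j=0}^{i-1}\Gamma_{B,C}(\sigma[t+j]).$$ Fix pure memoryless strategies $\mu$ (controller) and $\nu$ (environment), and let $\Pr_{\mu,\nu}^{i}$ be the law on infinite paths of the induced Markov chain started in $i\in S$. Then the series $G_t(\sigma)$ always converges, $G_t$ is integrable, the set of paths satisfying $\varphi_{B,C}=\square\lozenge B\wedge\neg\square\lozenge C$ ($B$ is visited infinitely often and $C$ only finitely often) is measurable, and for every state $s$ $$\lim_{\gamma\to1^-}v^\gamma_{\mu,\nu}(s)=\Pr\nolimits_{\mu,\nu}^{s}(\sigma\models\varphi_{B,C}),$$ where the value $v^\gamma_{\mu,\nu}(s)$ is the expectation of $G_0$ under $\Pr_{\mu,\nu}^{s}$; and the same limit holds when $v^\gamma_{\mu,\nu}(s)$ is taken to be the conditional expectation of $G_t$ given $\sigma[t]=s$ under $\Pr_{\mu,\nu}^{i}$, for any $i\in S$ and $t\in\mathbb N$ such that $\Pr_{\mu,\nu}^{i}(\sigma[t]=s)>0$. -/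

import Mathlib

open MeasureTheory ProbabilityTheory Filter Topology

/-- A turn-based two-player stochastic Rabin(1) game with finite state space `S` and action
space `A`. States outside `ctrl` belong to the environment. -/
structure RabinGame (S A : Type*) [Fintype S] where
  /-- the states in which the controller chooses the action -/
  ctrl : Set S
  /-- `avail s` is the set of actions that can be taken in `s` -/
  avail : S → Set A
  /-- transition probabilities -/
  P : S → A → S → ℝ
  P_nonneg : ∀ s a s', 0 ≤ P s a s'
  P_sum_avail : ∀ s a, a ∈ avail s → ∑ s', P s a s' = 1
  P_sum_not_avail : ∀ s a, a ∉ avail s → ∑ s', P s a s' = 0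
  /-- initial state -/
  init : S
  /-- first component of the accepting pair: to be visited only finitely often -/
  C : Set S
  /-- second component of the accepting pair: to be visited infinitely often -/
  B : Set S

namespace RabinGame

variable {S A : Type*} [Fintype S]

/-- A pure memoryless strategy of the controller. -/
structure ControlStrategy (G : RabinGame S A) where
  act : G.ctrl → A
  act_mem : ∀ s : G.ctrl, act s ∈ G.avail s

/-- A pure memoryless strategy of the environment. -/
structure EnvStrategy (G : RabinGame S A) where
  act : (G.ctrlᶜ : Set S) → A
  act_mem : ∀ s : (G.ctrlᶜ : Set S), act s ∈ G.avail s

open Classical in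
/-- The transition probabilities of the Markov chain induced by a strategy pair. -/
noncomputable def inducedP (G : RabinGame S A) (μ : G.ControlStrategy) (ν : G.EnvStrategy)
    (s s' : S) : ℝ :=
  if h : s ∈ G.ctrl then G.P s (μ.act ⟨s, h⟩) s' else G.P s (ν.act ⟨s, h⟩) s'

theorem inducedP_nonneg (G : RabinGame S A) (μ : G.ControlStrategy) (ν : G.EnvStrategy)
    (s s' : S) : 0 ≤ G.inducedP μ ν s s' := by
  unfold inducedP
  split_ifs <;> exact G.P_nonneg _ _ _

theorem inducedP_sum (G : RabinGame S A) (μ : G.ControlStrategy) (ν : G.EnvStrategy)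
    (s : S) : ∑ s', G.inducedP μ ν s s' = 1 := by
  unfold inducedP
  split_ifs with h
  · exact G.P_sum_avail _ _ (μ.act_mem ⟨s, h⟩)
  · exact G.P_sum_avail _ _ (ν.act_mem ⟨s, h⟩)

/-- The distribution of the next state of the induced Markov chain. -/
noncomputable def stepPMF (G : RabinGame S A) (μ : G.ControlStrategy) (ν : G.EnvStrategy)
    (s : S) : PMF S :=
  PMF.ofFintype (fun s' => ENNReal.ofReal (G.inducedP μ ν s s')) (by
    rw [← ENNReal.ofReal_sum_of_nonneg (fun s' _ => G.inducedP_nonneg μ ν s s'),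
      G.inducedP_sum, ENNReal.ofReal_one])

variable [MeasurableSpace S] [DiscreteMeasurableSpace S]

/-- The transition kernel of the induced Markov chain. -/
noncomputable def stepKernel (G : RabinGame S A) (μ : G.ControlStrategy) (ν : G.EnvStrategy) :
    Kernel S S where
  toFun s := (G.stepPMF μ ν s).toMeasure
  measurable' := Measurable.of_discrete

instance (G : RabinGame S A) (μ : G.ControlStrategy) (ν : G.EnvStrategy) :
    IsMarkovKernel (G.stepKernel μ ν) :=
  ⟨fun s => PMF.toMeasure.isProbabilityMeasure (G.stepPMF μ ν s)⟩

/-- The same kernel, as a kernel from histories of length `n + 1` to the next state: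
it reads only the last state of the history. -/
noncomputable def historyKernel (G : RabinGame S A) (μ : G.ControlStrategy) (ν : G.EnvStrategy)
    (n : ℕ) : Kernel (Finset.Iic n → S) S :=
  (G.stepKernel μ ν).comap (fun h => h ⟨n, Finset.mem_Iic.2 le_rfl⟩) (measurable_pi_apply _)

instance (G : RabinGame S A) (μ : G.ControlStrategy) (ν : G.EnvStrategy) (n : ℕ) :
    IsMarkovKernel (G.historyKernel μ ν n) := by
  unfold historyKernel; infer_instance

/-- The law, on the space of infinite paths, of the induced Markov chain started in `i`. -/
noncomputable def pathMeasure (G : RabinGame S A) (μ : G.ControlStrategy) (ν : G.EnvStrategy)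
    (i : S) : Measure (ℕ → S) :=
  Kernel.traj (X := fun _ => S) (G.historyKernel μ ν) 0 (fun _ => i)

/-- The `i`-th term of the return: `R (σ[t+i]) * ∏_{j < i} Γ (σ[t+j])`. -/
noncomputable def returnTerm (R Γ : S → ℝ) (t : ℕ) (σ : ℕ → S) (i : ℕ) : ℝ :=
  R (σ (t + i)) * ∏ j ∈ Finset.range i, Γ (σ (t + j))

/-- The return `G_t(σ)` of a path for the reward `R` and the state-dependent discount `Γ`. -/
noncomputable def pathReturn (R Γ : S → ℝ) (t : ℕ) (σ : ℕ → S) : ℝ :=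
  ∑' i, returnTerm R Γ t σ i

open Classical in
/-- The reward function: `1 - γB` on `B` and `0` elsewhere. -/
noncomputable def reward (G : RabinGame S A) (γB : ℝ) (s : S) : ℝ :=
  if s ∈ G.B then 1 - γB else 0

open Classical in
/-- The discount function: `γC` on `C`, `γB` on the rest of `B`, and `γ` elsewhere. -/
noncomputable def discount (G : RabinGame S A) (γ γB γC : ℝ) (s : S) : ℝ :=
  if s ∈ G.C then γC else if s ∈ G.B then γB else γ

/-- The value of `s`: the conditional expectation of `G_t(σ)` given `σ[t] = s`, for the induced
Markov chain started in `i`; meaningful when `σ[t] = s` has positive probability. -/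
noncomputable def value (G : RabinGame S A) (μ : G.ControlStrategy) (ν : G.EnvStrategy)
    (R Γ : S → ℝ) (i : S) (t : ℕ) (s : S) : ℝ :=
  ∫ σ, pathReturn R Γ t σ ∂(ProbabilityTheory.cond (G.pathMeasure μ ν i) {σ | σ t = s})

end RabinGame

/-- The temporal operators used, as operations on sets of infinite paths. -/
def LTL.atom {S : Type*} (U : Set S) : Set (ℕ → S) := {σ | σ 0 ∈ U}

/-- `◇ φ`: some suffix of the path satisfies `φ`. -/
def LTL.eventually {S : Type*} (φ : Set (ℕ → S)) : Set (ℕ → S) :=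
  {σ | ∃ n, (fun k => σ (n + k)) ∈ φ}

/-- `□ φ := ¬ ◇ ¬ φ`. -/
def LTL.always {S : Type*} (φ : Set (ℕ → S)) : Set (ℕ → S) :=
  (LTL.eventually φᶜ)ᶜ

/-- The Rabin condition `□◇B ∧ ¬□◇C`. -/
def RabinGame.rabinCondition {S A : Type*} [Fintype S] (G : RabinGame S A) : Set (ℕ → S) :=
  LTL.always (LTL.eventually (LTL.atom G.B)) ∩ (LTL.always (LTL.eventually (LTL.atom G.C)))ᶜ

/-! For fixed strategies the expected returns form a vector `v γ` in the cube `[0,1]^S` satisfying a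
Bellman equation (`integral_pathReturn_eq`). By compactness it converges along every ultrafilter
tending to `1` from the left, so it suffices to identify every such limit `w`. Rewards tend to `0`
and discounts to `1`, hence `w` is harmonic for the chain.

Harmonicity alone does not determine `w`; its values on recurrent classes come from the rates
(`FiniteChain.limit_of_bellman`). There `w` is constant, and averaging the Bellman equation with
stationary weights `q` cancels the transitions, leaving `∑ q (R - (1 - Γ) P v) = 0`. Dividing by the
coarsest scale present in the class decides the constant: `1 - γC` forces `0` if the class meets
`C`; otherwise `1 - γB` forces `1` if it meets `B`; if it meets neither, the value is `0` already
before the limit.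

Almost every path ends in a closed class and visits all its states infinitely often
(`ae_exists_recurrent`). So `w (σ n)` converges to the indicator of the Rabin condition, while its
expectation stays `w s`; dominated convergence gives the claim (`harmonic_eq_rabin`). Conditional
values reduce to time `0` by the Markov property (`pathMeasure_cond`). -/

namespace RabinGame

variable {S A : Type*} [Fintype S] [MeasurableSpace S] [DiscreteMeasurableSpace S]

/-! ### The path law and the Markov property -/

theorem stepKernel_singleton (G : RabinGame S A) (μ : G.ControlStrategy) (ν : G.EnvStrategy)
    (a b : S) : G.stepKernel μ ν a {b} = ENNReal.ofReal (G.inducedP μ ν a b) := by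
  change (G.stepPMF μ ν a).toMeasure {b} = _
  rw [PMF.toMeasure_apply_singleton _ _ (MeasurableSet.singleton b)]
  simp [stepPMF]

instance (G : RabinGame S A) (μ : G.ControlStrategy) (ν : G.EnvStrategy) (i : S) :
    IsProbabilityMeasure (G.pathMeasure μ ν i) := by
  unfold pathMeasure; infer_instance

/-- One-step Markov property: the event `F` of the first `m + 1` states forces `σ m = a`. -/
theorem pathMeasure_inter_succ (G : RabinGame S A) (μ : G.ControlStrategy) (ν : G.EnvStrategy)
    (i a b : S) (m : ℕ) (F : Set (Finset.Iic m → S))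
    (hF : ∀ h ∈ F, h ⟨m, Finset.mem_Iic.2 le_rfl⟩ = a) :
    G.pathMeasure μ ν i (Preorder.frestrictLe m ⁻¹' F ∩ {σ | σ (m + 1) = b}) =
      G.pathMeasure μ ν i (Preorder.frestrictLe m ⁻¹' F) *
        ENNReal.ofReal (G.inducedP μ ν a b) := by
  have hm : MeasurableSet F := F.toFinite.measurableSet
  have key := congrArg (fun Q => Q (F ×ˢ {b})) (Kernel.partialTraj_compProd_eq_map_traj
    (X := fun _ => S) (κ := G.historyKernel μ ν) (Nat.zero_le m) (x₀ := fun _ => i))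
  rw [Measure.compProd_apply_prod hm (MeasurableSet.singleton b),
    Measure.map_apply (by fun_prop) (hm.prod (MeasurableSet.singleton b))] at key
  have h1 : (fun x : ℕ → S => (Preorder.frestrictLe (π := fun _ => S) m x, x (m + 1))) ⁻¹'
      (F ×ˢ {b}) = Preorder.frestrictLe m ⁻¹' F ∩ {σ | σ (m + 1) = b} := rfl
  rw [h1] at key
  unfold pathMeasure
  rw [← key, setLIntegral_congr_fun (g := fun _ => ENNReal.ofReal (G.inducedP μ ν a b)) hm,
    setLIntegral_const, mul_comm, ← Kernel.traj_map_frestrictLe_apply,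
    Measure.map_apply (by fun_prop) hm]
  intro h hh
  simp only [historyKernel, Kernel.comap_apply, hF h hh, stepKernel_singleton]

theorem pathMeasure_zero (G : RabinGame S A) (μ : G.ControlStrategy) (ν : G.EnvStrategy)
    (i : S) : ∀ᵐ σ ∂G.pathMeasure μ ν i, σ 0 = i := by
  have h := Kernel.traj_map_frestrictLe_apply (X := fun _ => S) (κ := G.historyKernel μ ν) 0 0
    (fun _ => i)
  rw [Kernel.partialTraj_self, Kernel.id_apply] at h
  have h2 : ∀ᵐ x ∂(Measure.dirac (fun _ => i) : Measure (Finset.Iic 0 → S)),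
      x ⟨0, Finset.mem_Iic.2 le_rfl⟩ = i := by
    rw [ae_dirac_eq]; rfl
  rw [← h] at h2
  exact ae_of_ae_map (by fun_prop) h2

/-- A finite measure on paths is determined by its initial masses and its transition
probabilities. -/
theorem path_measure_ext {Q₁ Q₂ : Measure (ℕ → S)} [IsFiniteMeasure Q₁] [IsFiniteMeasure Q₂]
    (p : S → S → ENNReal)
    (h0 : ∀ x : S, Q₁ {σ | σ 0 = x} = Q₂ {σ | σ 0 = x})
    (h₁ : ∀ (x : ℕ → S) n, Q₁ {σ | ∀ k ≤ n + 1, σ k = x k} =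
      Q₁ {σ | ∀ k ≤ n, σ k = x k} * p (x n) (x (n + 1)))
    (h₂ : ∀ (x : ℕ → S) n, Q₂ {σ | ∀ k ≤ n + 1, σ k = x k} =
      Q₂ {σ | ∀ k ≤ n, σ k = x k} * p (x n) (x (n + 1))) : Q₁ = Q₂ := by
  have hcyl : ∀ (x : ℕ → S) n, Q₁ {σ | ∀ k ≤ n, σ k = x k} = Q₂ {σ | ∀ k ≤ n, σ k = x k} := by
    intro x n
    induction n with
    | zero => simpa using h0 (x 0)
    | succ n ih => rw [h₁, h₂, ih]
  have hmap : ∀ n, Q₁.map (Preorder.frestrictLe (π := fun _ => S) n) =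
      Q₂.map (Preorder.frestrictLe (π := fun _ => S) n) := by
    intro n
    refine Measure.ext_of_singleton fun y => ?_
    rw [Measure.map_apply (by fun_prop) (MeasurableSet.singleton y),
      Measure.map_apply (by fun_prop) (MeasurableSet.singleton y)]
    -- The history `y` is extended past time `n` by its last state, so that it becomes a full
    -- sequence to which `hcyl` applies.
    have : Preorder.frestrictLe (π := fun _ => S) n ⁻¹' {y} =
        {σ : ℕ → S | ∀ k ≤ n, σ k = (fun k => y ⟨min k n, by simp⟩) k} := by
      ext σ
      simp only [Set.mem_preimage, Set.mem_singleton_iff, Set.mem_ofPred_eq, funext_iff,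
        Subtype.forall, Finset.mem_Iic, Preorder.frestrictLe_apply]
      refine forall₂_congr fun k hk => ?_
      simp [min_eq_left hk]
    rw [this]
    exact hcyl _ n
  -- On `ℕ` the marginals on initial segments determine all finite marginals, and a projective limit
  -- of finite measures is unique.
  have hproj : IsProjectiveLimit Q₁ (fun I => Q₂.map I.restrict) := by
    refine (isProjectiveLimit_nat_iff ?_ Q₁).2 fun n => ?_
    · intro I J hJI
      rw [Measure.map_map (by fun_prop) (by fun_prop)]
      rfl
    · exact hmap n
  exact hproj.unique fun I => rfl

/-- The event at time `t` is carried along so that the recursion applies to the restricted measure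
in `map_shift_restrict`; if `x 0 ≠ s`, both sides vanish. -/
theorem pathMeasure_cyl_succ (G : RabinGame S A) (μ : G.ControlStrategy) (ν : G.EnvStrategy)
    (i s : S) (t : ℕ) (x : ℕ → S) (n : ℕ) :
    G.pathMeasure μ ν i ({σ | ∀ k ≤ n + 1, σ (t + k) = x k} ∩ {σ | σ t = s}) =
      G.pathMeasure μ ν i ({σ | ∀ k ≤ n, σ (t + k) = x k} ∩ {σ | σ t = s}) *
        ENNReal.ofReal (G.inducedP μ ν (x n) (x (n + 1))) := by
  have key := G.pathMeasure_inter_succ μ ν i (x n) (x (n + 1)) (t + n)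
    {h | (∀ k (hk : k ≤ n), h ⟨t + k, by simp; omega⟩ = x k) ∧ h ⟨t, by simp⟩ = s}
    (fun h hh => hh.1 n le_rfl)
  have h0 : {σ : ℕ → S | ∀ k ≤ n, σ (t + k) = x k} ∩ {σ | σ t = s} =
      Preorder.frestrictLe (t + n) ⁻¹'
        {h | (∀ k (hk : k ≤ n), h ⟨t + k, by simp; omega⟩ = x k) ∧ h ⟨t, by simp⟩ = s} := rfl
  rw [h0, ← key]
  congr 1
  ext σ
  simp only [Set.mem_inter_iff, Set.mem_ofPred_eq, Set.mem_preimage, Preorder.frestrictLe_apply]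
  constructor
  · rintro ⟨h, hs⟩
    exact ⟨⟨fun k hk => h k (by omega), hs⟩, h (n + 1) le_rfl⟩
  · rintro ⟨⟨h, hs⟩, h'⟩
    refine ⟨fun k hk => ?_, hs⟩
    rcases Nat.lt_or_ge n k with hk' | hk'
    · obtain rfl : k = n + 1 := by omega
      exact h'
    · exact h k hk'

/-- Markov property at time `t`. -/
theorem map_shift_restrict (G : RabinGame S A) (μ : G.ControlStrategy) (ν : G.EnvStrategy)
    (i s : S) (t : ℕ) :
    ((G.pathMeasure μ ν i).restrict {σ | σ t = s}).map (fun σ k => σ (t + k)) =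
      G.pathMeasure μ ν i {σ | σ t = s} • G.pathMeasure μ ν s := by
  have hsh : Measurable (fun (σ : ℕ → S) k => σ (t + k)) := by fun_prop
  have : IsFiniteMeasure (G.pathMeasure μ ν i {σ | σ t = s} • G.pathMeasure μ ν s) :=
    Measure.smul_finite _ (measure_ne_top _ _)
  have hms : ∀ (x : ℕ → S) (n : ℕ), MeasurableSet {σ : ℕ → S | ∀ k ≤ n, σ k = x k} := fun x n => by
    measurability
  refine path_measure_ext (fun a b => ENNReal.ofReal (G.inducedP μ ν a b)) ?_ ?_ ?_
  · intro x
    have hmx : MeasurableSet {σ : ℕ → S | σ 0 = x} := by measurability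
    rw [Measure.map_apply hsh hmx, Measure.restrict_apply (hsh hmx), Measure.smul_apply,
      smul_eq_mul]
    by_cases hx : x = s
    · subst hx
      rw [(prob_compl_eq_zero_iff hmx).1 (G.pathMeasure_zero μ ν x), mul_one]
      congr 1
      ext σ; simp
    · have h1 : G.pathMeasure μ ν s {σ | σ 0 = x} = 0 := by
        refine measure_mono_null ?_ (G.pathMeasure_zero μ ν s)
        intro σ hσ h'
        exact hx (hσ.symm.trans h')
      rw [h1, mul_zero]
      convert measure_empty (μ := G.pathMeasure μ ν i)
      ext σ
      simp only [Set.mem_inter_iff, Set.mem_preimage, Set.mem_ofPred_eq, add_zero,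
        Set.mem_empty_iff_false, iff_false, not_and]
      rintro h rfl
      exact hx h.symm
  · intro x n
    rw [Measure.map_apply hsh (hms _ _), Measure.map_apply hsh (hms _ _),
      Measure.restrict_apply (hsh (hms _ _)), Measure.restrict_apply (hsh (hms _ _))]
    exact G.pathMeasure_cyl_succ μ ν i s t x n
  · intro x n
    rw [Measure.smul_apply, Measure.smul_apply, smul_eq_mul, smul_eq_mul, mul_assoc]
    congr 1
    -- The chain from `s` starts at `s` almost surely, so the recursion with `t = 0` loses its extra
    -- event.
    have hae : ∀ U : Set (ℕ → S), G.pathMeasure μ ν s (U ∩ {σ | σ 0 = s}) =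
        G.pathMeasure μ ν s U := fun U =>
      measure_congr ((G.pathMeasure_zero μ ν s).mono fun σ hσ => by
        change (_ ∧ _) = _
        simp [hσ]
        rfl)
    have key := G.pathMeasure_cyl_succ μ ν s s 0 x n
    rw [hae, hae] at key
    simpa using key

/-- The law of the path shifted by `t` is a mixture of the laws of the chain. -/
theorem map_shift (G : RabinGame S A) (μ : G.ControlStrategy) (ν : G.EnvStrategy)
    (i : S) (t : ℕ) :
    (G.pathMeasure μ ν i).map (fun σ k => σ (t + k)) =
      Measure.sum fun s => G.pathMeasure μ ν i {σ | σ t = s} • G.pathMeasure μ ν s := by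
  simp_rw [← map_shift_restrict]
  rw [← Measure.map_sum (Measurable.aemeasurable (by fun_prop))]
  congr 1
  rw [← Measure.restrict_iUnion]
  · rw [show (⋃ s, {σ : ℕ → S | σ t = s}) = Set.univ by ext; simp, Measure.restrict_univ]
  · intro a b hab
    refine Set.disjoint_left.2 fun σ h h' => hab (h.symm.trans h')
  · intro s; measurability

theorem pathMeasure_one (G : RabinGame S A) (μ : G.ControlStrategy) (ν : G.EnvStrategy)
    (i s : S) : G.pathMeasure μ ν i {σ | σ 1 = s} = ENNReal.ofReal (G.inducedP μ ν i s) := by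
  have h1 : ∀ᵐ σ ∂G.pathMeasure μ ν i, σ 0 = i := G.pathMeasure_zero μ ν i
  have key := G.pathMeasure_inter_succ μ ν i i s 0 {h | h ⟨0, by simp⟩ = i} (fun h hh => hh)
  have h2 : G.pathMeasure μ ν i (Preorder.frestrictLe 0 ⁻¹' {h | h ⟨0, by simp⟩ = i}) = 1 :=
    (prob_compl_eq_zero_iff (by exact (by measurability : MeasurableSet {σ : ℕ → S | σ 0 = i}))).1 h1
  rw [h2, one_mul] at key
  rw [← key]
  refine measure_congr (h1.mono fun σ hσ => ?_)
  change (_ : Prop) = (_ ∧ _)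
  simp [hσ]
  rfl

theorem pathMeasure_cond (G : RabinGame S A) (μ : G.ControlStrategy) (ν : G.EnvStrategy)
    (i s : S) (t : ℕ) (h : G.pathMeasure μ ν i {σ | σ t = s} ≠ 0) :
    (ProbabilityTheory.cond (G.pathMeasure μ ν i) {σ | σ t = s}).map (fun σ k => σ (t + k)) =
      G.pathMeasure μ ν s := by
  rw [ProbabilityTheory.cond, Measure.map_smul, map_shift_restrict, smul_smul,
    ENNReal.inv_mul_cancel h (measure_ne_top _ _), one_smul]

/-- First-step analysis for integrals. -/
theorem integral_shift_one (G : RabinGame S A) (μ : G.ControlStrategy) (ν : G.EnvStrategy)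
    (i : S) {f : (ℕ → S) → ℝ} (hf : Measurable f) {c : ℝ} (hb : ∀ σ, |f σ| ≤ c) :
    ∫ σ, f (fun k => σ (1 + k)) ∂G.pathMeasure μ ν i =
      ∑ s, G.inducedP μ ν i s * ∫ σ, f σ ∂G.pathMeasure μ ν s := by
  have hint : ∀ s, Integrable f (G.pathMeasure μ ν s) := fun s =>
    Integrable.of_bound hf.aestronglyMeasurable c (ae_of_all _ hb)
  have h := integral_map (μ := G.pathMeasure μ ν i) (φ := fun σ k => σ (1 + k))
    (Measurable.aemeasurable (by fun_prop)) (f := f) hf.aestronglyMeasurable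
  rw [← h, map_shift, Measure.sum_fintype, integral_finsetSum_measure]
  · refine Finset.sum_congr rfl fun s _ => ?_
    rw [integral_smul_measure, pathMeasure_one,
      ENNReal.toReal_ofReal (G.inducedP_nonneg μ ν i s), smul_eq_mul]
  · intro s _
    exact (hint s).smul_measure (measure_ne_top _ _)

end RabinGame

/-! ### Finite chains: harmonic functions, stationary weights and limits of Bellman solutions -/

namespace FiniteChain

/-- Maximum principle: at a point where a subharmonic function is maximal, it is maximal at every
successor. -/
theorem eq_max_of_succ {T : Type*} [Fintype T] {p : T → T → ℝ} (hp : ∀ x y, 0 ≤ p x y)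
    (hs : ∀ x, ∑ y, p x y = 1) {w : T → ℝ} {M : ℝ} (hM : ∀ y, w y ≤ M) {x y : T}
    (hx : w x = M) (hw : w x ≤ ∑ y, p x y * w y) (hxy : 0 < p x y) : w y = M := by
  have h1 : ∑ y, p x y * (M - w y) ≤ 0 := by
    simp_rw [mul_sub, Finset.sum_sub_distrib, ← Finset.sum_mul, hs]
    linarith
  have h2 : ∀ y ∈ Finset.univ, 0 ≤ p x y * (M - w y) := fun y _ =>
    mul_nonneg (hp x y) (sub_nonneg.2 (hM y))
  have h3 := (Finset.sum_eq_zero_iff_of_nonneg h2).1 (le_antisymm h1 (Finset.sum_nonneg h2)) y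
    (Finset.mem_univ y)
  rcases mul_eq_zero.1 h3 with h | h
  · exact absurd h hxy.ne'
  · linarith

variable {T : Type*} [Fintype T] {p : T → T → ℝ}

theorem eq_of_harmonic (hp : ∀ x y, 0 ≤ p x y) (hs : ∀ x, ∑ y, p x y = 1)
    (hirr : ∀ x y, Relation.ReflTransGen (fun a b => 0 < p a b) x y) {w : T → ℝ}
    (hw : ∀ x, w x = ∑ y, p x y * w y) (x y : T) : w x = w y := by
  have : Nonempty T := ⟨x⟩
  obtain ⟨m, hm⟩ := Finite.exists_max w
  have key : ∀ z, w z = w m := fun z => by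
    induction hirr m z with
    | refl => rfl
    | tail _ h ih => exact eq_max_of_succ hp hs hm ih (hw _).le h
  rw [key x, key y]

/-- Since `p - 1` kills constants it is singular and has a left null vector `v`. The triangle
inequality gives `|v| ≤ |v| p`; both sides have the same total, so `|v|` is stationary.
Irreducibility spreads its positivity from one point to all. -/
theorem exists_stationary [Nonempty T] (hp : ∀ x y, 0 ≤ p x y) (hs : ∀ x, ∑ y, p x y = 1)
    (hirr : ∀ x y, Relation.ReflTransGen (fun a b => 0 < p a b) x y) :
    ∃ q : T → ℝ, (∀ x, 0 < q x) ∧ ∀ y, ∑ x, q x * p x y = q y := by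
  classical
  have hdet : (Matrix.of p - 1).det = 0 := by
    refine Matrix.exists_mulVec_eq_zero_iff.1 ⟨1, one_ne_zero, ?_⟩
    ext x
    rw [Matrix.sub_mulVec, Matrix.one_mulVec]
    simp [Matrix.mulVec, dotProduct, hs]
  obtain ⟨v, hv0, hv⟩ := Matrix.exists_vecMul_eq_zero_iff.2 hdet
  have hv' : ∀ y, ∑ x, v x * p x y = v y := fun y => by
    have := congrFun hv y
    rw [Matrix.vecMul_sub, Matrix.vecMul_one] at this
    simpa [Matrix.vecMul, dotProduct, sub_eq_zero] using this
  have hle : ∀ y ∈ Finset.univ, |v y| ≤ ∑ x, |v x| * p x y := fun y _ => by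
    rw [← hv' y]
    refine (Finset.abs_sum_le_sum_abs _ _).trans (Finset.sum_le_sum fun x _ => ?_)
    rw [abs_mul, abs_of_nonneg (hp x y)]
  have hsum : ∑ y, |v y| = ∑ y, ∑ x, |v x| * p x y := by
    rw [Finset.sum_comm]
    simp_rw [← Finset.mul_sum, hs, mul_one]
  have heq := (Finset.sum_eq_sum_iff_of_le hle).1 hsum
  obtain ⟨x₀, hx₀⟩ := Function.ne_iff.1 hv0
  refine ⟨fun x => |v x|, fun z => ?_, fun y => (heq y (Finset.mem_univ y)).symm⟩
  induction hirr x₀ z with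
  | refl => exact abs_pos.2 hx₀
  | @tail b c _ h ih =>
    refine lt_of_lt_of_eq ?_ (heq c (Finset.mem_univ c)).symm
    exact Finset.sum_pos' (fun x _ => mul_nonneg (abs_nonneg _) (hp _ _))
      ⟨b, Finset.mem_univ b, mul_pos ih h⟩

open Classical in
/-- The limit of the discounted values on an irreducible chain. -/
theorem limit_of_bellman (hp : ∀ x y, 0 ≤ p x y) (hs : ∀ x, ∑ y, p x y = 1)
    (hirr : ∀ x y, Relation.ReflTransGen (fun a b => 0 < p a b) x y) (B C : Set T)
    {γB γC : ℝ → ℝ} {g : Filter ℝ} [g.NeBot]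
    (hγ : ∀ᶠ γ in g, γC γ < γB γ ∧ γB γ < γ ∧ γ < 1)
    (h1 : Tendsto (fun γ => γ) g (𝓝 1))
    (hB : Tendsto γB g (𝓝 1)) (hC : Tendsto γC g (𝓝 1))
    (hγB : Tendsto (fun γ => (1 - γ) / (1 - γB γ)) g (𝓝 0))
    (hBC : Tendsto (fun γ => (1 - γB γ) / (1 - γC γ)) g (𝓝 0))
    {v : ℝ → T → ℝ} (hv0 : ∀ᶠ γ in g, ∀ x, 0 ≤ v γ x)
    (hv : ∀ᶠ γ in g, ∀ x, v γ x = (if x ∈ B then 1 - γB γ else 0) +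
      (if x ∈ C then γC γ else if x ∈ B then γB γ else γ) * ∑ y, p x y * v γ y)
    {w : T → ℝ} (hw : ∀ x, Tendsto (fun γ => v γ x) g (𝓝 (w x))) (x : T) :
    w x = if B.Nonempty ∧ ¬ C.Nonempty then 1 else 0 := by
  have : Nonempty T := ⟨x⟩
  obtain ⟨q, hq, hqp⟩ := exists_stationary hp hs hirr
  have hu : ∀ x, Tendsto (fun γ => ∑ y, p x y * v γ y) g (𝓝 (∑ y, p x y * w y)) := fun x =>
    tendsto_finsetSum _ fun y _ => (hw y).const_mul _
  have hharm : ∀ x, w x = ∑ y, p x y * w y := fun x => by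
    refine tendsto_nhds_unique (hw x) ?_
    have h2 : Tendsto (fun γ => (if x ∈ B then 1 - γB γ else 0) +
        (if x ∈ C then γC γ else if x ∈ B then γB γ else γ) * ∑ y, p x y * v γ y) g
        (𝓝 (0 + 1 * ∑ y, p x y * w y)) := by
      refine Tendsto.add ?_ (Tendsto.mul ?_ (hu x))
      · split_ifs
        · simpa using hB.const_sub 1
        · exact tendsto_const_nhds
      · split_ifs <;> assumption
    rw [zero_add, one_mul] at h2
    exact h2.congr' (hv.mono fun γ h => (h x).symm)
  have hconst : ∀ y, w y = w x := fun y => eq_of_harmonic hp hs hirr hharm y x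
  have hu' : ∀ y, Tendsto (fun γ => ∑ z, p y z * v γ z) g (𝓝 (w x)) := fun y => by
    have := hu y
    rwa [← hharm y, hconst y] at this
  -- This identity is exact for each such `γ`: by Bellman the left side is `∑ q v - ∑ q P v`, which
  -- is zero by stationarity.
  have hid : ∀ᶠ γ in g, ∑ y, q y * ((if y ∈ B then 1 - γB γ else 0) -
      (1 - if y ∈ C then γC γ else if y ∈ B then γB γ else γ) * ∑ z, p y z * v γ z) = 0 := by
    filter_upwards [hv] with γ h
    have e1 : ∀ y, q y * ((if y ∈ B then 1 - γB γ else 0) -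
        (1 - if y ∈ C then γC γ else if y ∈ B then γB γ else γ) * ∑ z, p y z * v γ z) =
        q y * v γ y - ∑ z, q y * p y z * v γ z := fun y => by
      simp_rw [mul_assoc, ← Finset.mul_sum]
      rw [h y]; ring
    rw [Finset.sum_congr rfl fun y _ => e1 y, Finset.sum_sub_distrib, Finset.sum_comm]
    simp_rw [← Finset.sum_mul, hqp, sub_self]
  /- Dividing the stationary identity by a normalisation `d` and passing to the limit. -/
  have hlim : ∀ (d : ℝ → ℝ) (r l : T → ℝ),
      (∀ y, Tendsto (fun γ => (if y ∈ B then 1 - γB γ else 0) / d γ) g (𝓝 (r y))) →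
      (∀ y, Tendsto (fun γ => (1 - if y ∈ C then γC γ else if y ∈ B then γB γ else γ) / d γ) g
        (𝓝 (l y))) → ∑ y, q y * (r y - l y * w x) = 0 := by
    intro d r l hr hl
    have h3 := tendsto_finsetSum Finset.univ fun y (_ : y ∈ Finset.univ) =>
      (((hr y).sub ((hl y).mul (hu' y))).const_mul (q y))
    refine tendsto_nhds_unique h3 (tendsto_const_nhds.congr' ?_)
    filter_upwards [hid] with γ h
    refine (zero_div (d γ)).symm.trans ((congrArg (· / d γ) h).symm.trans ?_)
    refine (Finset.sum_div _ _ _).trans ?_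
    exact Finset.sum_congr rfl fun y _ => by ring
  by_cases hCn : C.Nonempty
  -- The scale `1 - γC` dominates: `1 - γB` and, by multiplying the two ratios, `1 - γ` are
  -- negligible against it. Only `-w x` times the mass of `C` survives.
  · rw [if_neg (by tauto)]
    have hCC : Tendsto (fun γ => (1 - γC γ) / (1 - γC γ)) g (𝓝 1) :=
      tendsto_const_nhds.congr' (hγ.mono fun γ h => (div_self (by linarith)).symm)
    have hγC : Tendsto (fun γ => (1 - γ) / (1 - γC γ)) g (𝓝 0) := by
      rw [← zero_mul 0]
      refine (hγB.mul hBC).congr' (hγ.mono fun γ h => ?_)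
      exact div_mul_div_cancel₀ (by linarith)
    have h4 := hlim (fun γ => 1 - γC γ) (fun _ => 0) (fun y => if y ∈ C then 1 else 0)
      (fun y => by
        split_ifs
        · exact hBC
        · simp)
      (fun y => by split_ifs <;> assumption)
    obtain ⟨z, hz⟩ := hCn
    have h5 : (∑ y, q y * if y ∈ C then 1 else 0) * w x = 0 := by
      refine Eq.trans ?_ (neg_eq_zero.2 h4)
      rw [Finset.sum_mul, ← Finset.sum_neg_distrib]
      exact Finset.sum_congr rfl fun y _ => by ring
    refine (mul_eq_zero.1 h5).resolve_left (ne_of_gt ?_)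
    refine Finset.sum_pos' (fun y _ => mul_nonneg (hq y).le (by split_ifs <;> norm_num))
      ⟨z, Finset.mem_univ z, ?_⟩
    rw [if_pos hz, mul_one]; exact hq z
  have hC' : ∀ y, y ∉ C := fun y hy => hCn ⟨y, hy⟩
  by_cases hBn : B.Nonempty
  -- At scale `1 - γB`, reward and discount loss on `B` have the same limit `1`, which leaves the
  -- mass of `B` times `1 - w x`.
  · rw [if_pos ⟨hBn, hCn⟩]
    have hBB : Tendsto (fun γ => (1 - γB γ) / (1 - γB γ)) g (𝓝 1) :=
      tendsto_const_nhds.congr' (hγ.mono fun γ h => (div_self (by linarith)).symm)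
    have h4 := hlim (fun γ => 1 - γB γ) (fun y => if y ∈ B then 1 else 0)
      (fun y => if y ∈ B then 1 else 0)
      (fun y => by
        split_ifs
        · exact hBB
        · simp)
      (fun y => by
        simp only [hC', if_false]
        split_ifs <;> assumption)
    obtain ⟨z, hz⟩ := hBn
    have h5 : (∑ y, q y * if y ∈ B then 1 else 0) * (1 - w x) = 0 := by
      refine Eq.trans ?_ h4
      rw [Finset.sum_mul]
      exact Finset.sum_congr rfl fun y _ => by ring
    suffices 1 - w x = 0 by linarith
    refine (mul_eq_zero.1 h5).resolve_left (ne_of_gt ?_)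
    refine Finset.sum_pos' (fun y _ => mul_nonneg (hq y).le (by split_ifs <;> norm_num))
      ⟨z, Finset.mem_univ z, ?_⟩
    rw [if_pos hz, mul_one]; exact hq z
  -- No reward occurs, so the identity is a vanishing sum of nonnegative terms. Each term is zero,
  -- and hence so is `v γ x`.
  · rw [if_neg (by tauto)]
    have hB' : ∀ y, y ∉ B := fun y hy => hBn ⟨y, hy⟩
    refine tendsto_nhds_unique (hw x) (tendsto_const_nhds.congr' ?_)
    filter_upwards [hid, hv, hγ, hv0] with γ h hv hγ hv0
    simp only [hB', hC', if_false, zero_sub, zero_add] at h hv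
    have hu0 : ∀ y, 0 ≤ ∑ z, p y z * v γ z := fun y =>
      Finset.sum_nonneg fun z _ => mul_nonneg (hp y z) (hv0 z)
    have h6 : ∑ y, q y * ((1 - γ) * ∑ z, p y z * v γ z) = 0 := by
      rw [← neg_eq_zero, ← h, ← Finset.sum_neg_distrib]
      exact Finset.sum_congr rfl fun y _ => by ring
    have h7 := (Finset.sum_eq_zero_iff_of_nonneg fun y _ => mul_nonneg (hq y).le
      (mul_nonneg (by linarith) (hu0 y))).1 h6 x (Finset.mem_univ x)
    have h8 := (mul_eq_zero.1 ((mul_eq_zero.1 h7).resolve_left (hq x).ne')).resolve_left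
      (by linarith)
    rw [hv x, h8, mul_zero]

open Classical in
/-- The limit of the discounted values at a recurrent state of a finite chain. -/
theorem limit_of_recurrent (hp : ∀ x y, 0 ≤ p x y) (hs : ∀ x, ∑ y, p x y = 1) {r : T}
    (hrec : ∀ y, Relation.ReflTransGen (fun a b => 0 < p a b) r y →
      Relation.ReflTransGen (fun a b => 0 < p a b) y r) (B C : Set T)
    {γB γC : ℝ → ℝ} {g : Filter ℝ} [g.NeBot]
    (hγ : ∀ᶠ γ in g, γC γ < γB γ ∧ γB γ < γ ∧ γ < 1)
    (h1 : Tendsto (fun γ => γ) g (𝓝 1))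
    (hB : Tendsto γB g (𝓝 1)) (hC : Tendsto γC g (𝓝 1))
    (hγB : Tendsto (fun γ => (1 - γ) / (1 - γB γ)) g (𝓝 0))
    (hBC : Tendsto (fun γ => (1 - γB γ) / (1 - γC γ)) g (𝓝 0))
    {v : ℝ → T → ℝ} (hv0 : ∀ᶠ γ in g, ∀ x, 0 ≤ v γ x)
    (hv : ∀ᶠ γ in g, ∀ x, v γ x = (if x ∈ B then 1 - γB γ else 0) +
      (if x ∈ C then γC γ else if x ∈ B then γB γ else γ) * ∑ y, p x y * v γ y)
    {w : T → ℝ} (hw : ∀ x, Tendsto (fun γ => v γ x) g (𝓝 (w x))) {x : T}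
    (hx : Relation.ReflTransGen (fun a b => 0 < p a b) r x) :
    w x = if (∃ y ∈ B, Relation.ReflTransGen (fun a b => 0 < p a b) r y) ∧
      ¬ (∃ y ∈ C, Relation.ReflTransGen (fun a b => 0 < p a b) r y) then 1 else 0 := by
  set D : Set T := {y | Relation.ReflTransGen (fun a b => 0 < p a b) r y} with hD
  have hclosed : ∀ a : D, ∀ y, 0 < p a y → y ∈ D := fun a y h => a.2.tail h
  -- `D` is closed, so no mass leaves it and sums over `T` restrict to `D`; recurrence of `r` makes
  -- the restricted chain irreducible.
  have hsum : ∀ (f : T → ℝ) (a : D), ∑ y, p a y * f y = ∑ y : D, p a y * f y := fun f a => by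
    rw [← Finset.sum_subtype (Finset.univ.filter (· ∈ D)) (by simp) (fun y => p a y * f y)]
    refine (Finset.sum_subset (Finset.subset_univ _) fun y _ hy => ?_).symm
    have hy' : y ∉ D := by simpa using hy
    rw [le_antisymm (not_lt.1 fun h => hy' (hclosed a y h)) (hp a y), zero_mul]
  have hlift : ∀ (a : D) (y : T), Relation.ReflTransGen (fun a b => 0 < p a b) a y →
      ∃ hy : y ∈ D, Relation.ReflTransGen (fun a b : D => 0 < p a b) a ⟨y, hy⟩ := by
    intro a y h
    induction h with
    | refl => exact ⟨a.2, .refl⟩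
    | tail _ h ih =>
      obtain ⟨hb, hab⟩ := ih
      exact ⟨hclosed ⟨_, hb⟩ _ h, hab.tail h⟩
  have key := limit_of_bellman (p := fun a b : D => p a b) (fun a b => hp a b)
    (fun a => by simpa using (hsum 1 a).symm.trans (by simpa using hs a))
    (fun a b => (hlift a b ((hrec a a.2).trans b.2)).2)
    (Subtype.val ⁻¹' B) (Subtype.val ⁻¹' C) hγ h1 hB hC hγB hBC
    (v := fun γ a => v γ a) (hv0.mono fun γ h a => h a)
    (hv.mono fun γ h a => by rw [h a, hsum]; rfl) (w := fun a => w a) (fun a => hw a) ⟨x, hx⟩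
  have hne : ∀ U : Set T, (Subtype.val ⁻¹' U : Set D).Nonempty ↔
      ∃ y ∈ U, Relation.ReflTransGen (fun a b => 0 < p a b) r y := fun U =>
    ⟨fun ⟨a, ha⟩ => ⟨a, ha, a.2⟩, fun ⟨y, hy, h⟩ => ⟨⟨y, h⟩, hy⟩⟩
  simpa only [hne] using key

end FiniteChain

/-! ### Long-run behaviour of paths and the Rabin condition -/

namespace RabinGame

/-- `□◇U` says that `U` is visited infinitely often. -/
theorem mem_always_eventually_atom {S : Type*} {U : Set S} {σ : ℕ → S} :
    σ ∈ LTL.always (LTL.eventually (LTL.atom U)) ↔ ∃ᶠ n in atTop, σ n ∈ U := by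
  rw [frequently_atTop]
  have h : σ ∈ LTL.always (LTL.eventually (LTL.atom U)) ↔ ¬ ∃ n, ¬ ∃ m, σ (n + (m + 0)) ∈ U := Iff.rfl
  rw [h]
  push Not
  refine forall_congr' fun n => ⟨fun ⟨m, hm⟩ => ⟨n + m, Nat.le_add_right _ _, hm⟩, ?_⟩
  rintro ⟨m, hnm, hm⟩
  exact ⟨m - n, by rwa [add_zero, Nat.add_sub_cancel' hnm]⟩

theorem reachable_of_steps {S : Type*} {q : S → S → Prop} {σ : ℕ → S} (h : ∀ n, q (σ n) (σ (n + 1)))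
    {m n : ℕ} (hmn : m ≤ n) : Relation.ReflTransGen q (σ m) (σ n) := by
  induction n, hmn using Nat.le_induction with
  | base => exact .refl
  | succ n _ ih => exact ih.tail (h n)

variable {S A : Type*} [Fintype S]

/-- Pigeonhole on the finite state space. -/
theorem frequently_mem_iff {U : Set S} {σ : ℕ → S} :
    (∃ᶠ n in atTop, σ n ∈ U) ↔ ∃ y ∈ U, ∃ᶠ n in atTop, σ n = y := by
  constructor
  · intro h
    by_contra hcon
    push Not at hcon
    have h2 : ∀ᶠ n in atTop, ∀ y : S, y ∈ U → σ n ≠ y :=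
      eventually_all.2 fun y => by
        by_cases hy : y ∈ U
        · exact (hcon y hy).mono fun n hn _ => hn
        · exact Eventually.of_forall fun n h => absurd h hy
    obtain ⟨n, hn, hn'⟩ := (h.and_eventually h2).exists
    exact hn' _ hn rfl
  · rintro ⟨y, hy, h⟩
    exact h.mono fun n hn => hn ▸ hy

theorem mem_rabinCondition (G : RabinGame S A) {σ : ℕ → S} : σ ∈ G.rabinCondition ↔
    (∃ y ∈ G.B, ∃ᶠ n in atTop, σ n = y) ∧ ¬ ∃ y ∈ G.C, ∃ᶠ n in atTop, σ n = y := by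
  rw [← frequently_mem_iff, ← frequently_mem_iff, ← mem_always_eventually_atom,
    ← mem_always_eventually_atom]
  rfl

/-- A path that follows the relation `q` and visits infinitely often every `q`-successor of a
state visited infinitely often settles in a closed communicating class. -/
theorem exists_recurrent_of_steps {q : S → S → Prop} {σ : ℕ → S}
    (h : ∀ n, q (σ n) (σ (n + 1)))
    (hio : ∀ a b, q a b → (∃ᶠ n in atTop, σ n = a) → ∃ᶠ n in atTop, σ n = b) :
    ∃ r, (∀ y, Relation.ReflTransGen q r y → Relation.ReflTransGen q y r) ∧
      (∀ y, (∃ᶠ n in atTop, σ n = y) ↔ Relation.ReflTransGen q r y) ∧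
      ∀ᶠ n in atTop, Relation.ReflTransGen q r (σ n) := by
  obtain ⟨r, -, hr⟩ := (frequently_mem_iff (U := Set.univ) (σ := σ)).1
    (Frequently.of_forall fun _ => Set.mem_univ _)
  have h1 : ∀ y, Relation.ReflTransGen q r y → ∃ᶠ n in atTop, σ n = y := by
    intro y hy
    induction hy with
    | refl => exact hr
    | tail _ hbc ih => exact hio _ _ hbc ih
  have h2 : ∀ x y, (∃ᶠ n in atTop, σ n = x) → (∃ᶠ n in atTop, σ n = y) →
      Relation.ReflTransGen q x y := by
    intro x y hx hy
    obtain ⟨m, -, rfl⟩ := frequently_atTop.1 hx 0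
    obtain ⟨n, hmn, rfl⟩ := frequently_atTop.1 hy m
    exact reachable_of_steps h hmn
  refine ⟨r, fun y hy => h2 _ _ (h1 y hy) hr, fun y => ⟨h2 r y hr, h1 y⟩, ?_⟩
  obtain ⟨m, -, rfl⟩ := frequently_atTop.1 hr 0
  exact eventually_atTop.2 ⟨m, fun n hn => reachable_of_steps h hn⟩

variable [MeasurableSpace S] [DiscreteMeasurableSpace S]

theorem measurableSet_frequently_eq (y : S) :
    MeasurableSet {σ : ℕ → S | ∃ᶠ n in atTop, σ n = y} := by
  simp_rw [frequently_atTop]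
  measurability

theorem measurableSet_rabinCondition (G : RabinGame S A) : MeasurableSet G.rabinCondition := by
  have h : G.rabinCondition = (⋃ y ∈ G.B, {σ : ℕ → S | ∃ᶠ n in atTop, σ n = y}) ∩
      (⋃ y ∈ G.C, {σ : ℕ → S | ∃ᶠ n in atTop, σ n = y})ᶜ := by
    ext σ
    rw [mem_rabinCondition]
    simp
  rw [h]
  exact (MeasurableSet.biUnion (Set.to_countable _) fun y _ => measurableSet_frequently_eq y).inter
    (MeasurableSet.biUnion (Set.to_countable _) fun y _ => measurableSet_frequently_eq y).compl

theorem ae_steps_pos (G : RabinGame S A) (μ : G.ControlStrategy) (ν : G.EnvStrategy) (i : S) :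
    ∀ᵐ σ ∂G.pathMeasure μ ν i, ∀ n, 0 < G.inducedP μ ν (σ n) (σ (n + 1)) := by
  have h : ∀ n (a b : S), ∀ᵐ σ ∂G.pathMeasure μ ν i, ¬ 0 < G.inducedP μ ν a b →
      ¬ (σ n = a ∧ σ (n + 1) = b) := by
    intro n a b
    by_cases hab : 0 < G.inducedP μ ν a b
    · simp [hab]
    · have key := G.pathMeasure_inter_succ μ ν i a b n {h | h ⟨n, by simp⟩ = a} (fun h hh => hh)
      rw [ENNReal.ofReal_of_nonpos (not_lt.1 hab), mul_zero] at key
      refine measure_mono_null ?_ key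
      intro σ hσ
      by_contra hcon
      exact hσ fun _ h => hcon h
  filter_upwards [ae_all_iff.2 fun n => ae_all_iff.2 fun a => ae_all_iff.2 fun b => h n a b]
    with σ hσ n
  by_contra hcon
  exact hσ n _ _ hcon ⟨rfl, rfl⟩

/-- A successor of a state visited infinitely often is almost surely visited infinitely often. -/
theorem ae_frequently_succ (G : RabinGame S A) (μ : G.ControlStrategy) (ν : G.EnvStrategy)
    (i : S) {a b : S} (hab : 0 < G.inducedP μ ν a b) :
    ∀ᵐ σ ∂G.pathMeasure μ ν i, (∃ᶠ n in atTop, σ n = a) → ∃ᶠ n in atTop, σ n = b := by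
  -- `E` survives deletion of the first state, so its probability `h` is subharmonic in the starting
  -- state. It vanishes at `b`, and the maximum principle will carry any positive maximum along a
  -- path to `a` and on to `b`.
  set E : Set (ℕ → S) := {σ | (∃ᶠ n in atTop, σ n = a) ∧ ∀ n, σ n ≠ b} with hE
  have hmE : MeasurableSet E := by
    refine (measurableSet_frequently_eq a).inter ?_
    change MeasurableSet {σ : ℕ → S | ∀ n, σ n ≠ b}
    measurability
  have hfreq : ∀ (σ : ℕ → S) n, (∃ᶠ k in atTop, σ (n + k) = a) ↔ ∃ᶠ k in atTop, σ k = a := by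
    intro σ n
    simp_rw [add_comm n]
    rw [← frequently_map (m := fun k => k + n) (P := fun k => σ k = a), map_add_atTop_eq_nat]
  set h : S → ℝ := fun x => (G.pathMeasure μ ν x).real E with hh
  have hint : ∀ x, h x = ∫ σ, E.indicator 1 σ ∂G.pathMeasure μ ν x := fun x =>
    (integral_indicator_one hmE).symm
  have hind : ∀ σ, |E.indicator (1 : (ℕ → S) → ℝ) σ| ≤ 1 := fun σ => by
    by_cases hσ : σ ∈ E <;> simp [hσ]
  have hmi : Measurable (E.indicator (1 : (ℕ → S) → ℝ)) := measurable_one.indicator hmE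
  have hsub : ∀ x, h x ≤ ∑ y, G.inducedP μ ν x y * h y := by
    intro x
    simp_rw [hint]
    rw [← integral_shift_one G μ ν x hmi hind]
    refine integral_mono (Integrable.of_bound hmi.aestronglyMeasurable 1 (ae_of_all _ hind))
      (Integrable.of_bound (hmi.comp (by fun_prop)).aestronglyMeasurable 1
        (ae_of_all _ fun σ => hind _)) fun σ => ?_
    change E.indicator (1 : (ℕ → S) → ℝ) σ ≤ E.indicator (1 : (ℕ → S) → ℝ) fun k => σ (1 + k)
    by_cases hσ : σ ∈ E
    · have hσ' : (fun k => σ (1 + k)) ∈ E := ⟨(hfreq σ 1).2 hσ.1, fun n => hσ.2 _⟩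
      simp [hσ, hσ']
    · rw [Set.indicator_of_notMem hσ]
      exact Set.indicator_nonneg (fun _ _ => zero_le_one) _
  have hb : h b = 0 := by
    have : G.pathMeasure μ ν b E = 0 :=
      measure_mono_null (fun σ hσ h0 => hσ.2 0 h0) (G.pathMeasure_zero μ ν b)
    simp [hh, Measure.real, this]
  have hzero : ∀ x, h x = 0 := by
    have : Nonempty S := ⟨a⟩
    obtain ⟨m, hm⟩ := Finite.exists_max h
    suffices h m ≤ 0 from fun x => le_antisymm ((hm x).trans this) measureReal_nonneg
    by_contra hpos
    have hreach : ∀ y, Relation.ReflTransGen (fun a b => 0 < G.inducedP μ ν a b) m y →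
        h y = h m := by
      intro y hy
      induction hy with
      | refl => rfl
      | tail _ hbc ih =>
        exact FiniteChain.eq_max_of_succ (G.inducedP_nonneg μ ν) (G.inducedP_sum μ ν) hm ih
          (hsub _) hbc
    -- Positive probability supplies an actual path in `E` from `m` with positive steps; it visits
    -- `a`, so `b` is reachable from `m`.
    have hne : ∃ᵐ σ ∂G.pathMeasure μ ν m, σ ∈ E := by
      rw [frequently_ae_mem_iff]
      intro h0
      exact hpos (by simp [hh, Measure.real, h0])
    obtain ⟨σ, hσE, h0, hstep⟩ := (hne.and_eventually
      ((G.pathMeasure_zero μ ν m).and (G.ae_steps_pos μ ν m))).exists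
    obtain ⟨n, -, hn⟩ := frequently_atTop.1 hσE.1 0
    have hma := reachable_of_steps (q := fun a b => 0 < G.inducedP μ ν a b) hstep (Nat.zero_le n)
    rw [h0, hn] at hma
    have := hreach b (hma.tail hab)
    rw [hb] at this
    exact hpos this.ge
  -- The shifted law is a mixture of chain laws, all of which give `E` measure zero. If `b` occurred
  -- finitely often but `a` infinitely often, some tail would lie in `E`.
  have hshift : ∀ n, ∀ᵐ σ ∂G.pathMeasure μ ν i, (fun k => σ (n + k)) ∉ E := by
    intro n
    refine ae_of_ae_map (μ := G.pathMeasure μ ν i) (f := fun σ k => σ (n + k)) (p := fun τ => τ ∉ E)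
      (Measurable.aemeasurable (by fun_prop)) ?_
    rw [map_shift, Measure.ae_sum_iff]
    intro s
    refine Measure.ae_smul_measure ?_ _
    have := hzero s
    rw [hh, measureReal_eq_zero_iff] at this
    exact measure_eq_zero_iff_ae_notMem.1 this
  filter_upwards [ae_all_iff.2 hshift] with σ hσ ha
  by_contra hcon
  obtain ⟨n, hn⟩ := eventually_atTop.1 (not_frequently.1 hcon)
  exact hσ n ⟨(hfreq σ n).2 ha, fun k => hn _ (Nat.le_add_right _ _)⟩

theorem ae_exists_recurrent (G : RabinGame S A) (μ : G.ControlStrategy) (ν : G.EnvStrategy)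
    (i : S) : ∀ᵐ σ ∂G.pathMeasure μ ν i,
      ∃ r, (∀ y, Relation.ReflTransGen (fun a b => 0 < G.inducedP μ ν a b) r y →
        Relation.ReflTransGen (fun a b => 0 < G.inducedP μ ν a b) y r) ∧
      (∀ y, (∃ᶠ n in atTop, σ n = y) ↔
        Relation.ReflTransGen (fun a b => 0 < G.inducedP μ ν a b) r y) ∧
      ∀ᶠ n in atTop, Relation.ReflTransGen (fun a b => 0 < G.inducedP μ ν a b) r (σ n) := by
  have h : ∀ a b : S, ∀ᵐ σ ∂G.pathMeasure μ ν i, 0 < G.inducedP μ ν a b →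
      (∃ᶠ n in atTop, σ n = a) → ∃ᶠ n in atTop, σ n = b := fun a b => by
    by_cases hab : 0 < G.inducedP μ ν a b
    · exact (G.ae_frequently_succ μ ν i hab).mono fun σ h _ => h
    · simp [hab]
  filter_upwards [G.ae_steps_pos μ ν i, ae_all_iff.2 fun a => ae_all_iff.2 fun b => h a b]
    with σ h1 h2
  exact exists_recurrent_of_steps h1 h2

/-- The process `w (σ n)` is a martingale; only the constancy of its expectation is needed. -/
theorem integral_harmonic (G : RabinGame S A) (μ : G.ControlStrategy) (ν : G.EnvStrategy)
    {w : S → ℝ} (hw : ∀ x, w x = ∑ y, G.inducedP μ ν x y * w y) (n : ℕ) (s : S) :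
    ∫ σ, w (σ n) ∂G.pathMeasure μ ν s = w s := by
  induction n generalizing s with
  | zero =>
    rw [integral_congr_ae (g := fun _ => w s)
      ((G.pathMeasure_zero μ ν s).mono fun σ h => by simp [h])]
    simp
  | succ n ih =>
    have hm : Measurable fun σ : ℕ → S => w (σ n) :=
      (Measurable.of_discrete (f := w)).comp (measurable_pi_apply n)
    have key := G.integral_shift_one μ ν s hm (c := ∑ y, |w y|) fun σ =>
      Finset.single_le_sum (f := fun y => |w y|) (fun y _ => abs_nonneg _) (Finset.mem_univ _)
    simp_rw [ih, add_comm 1 n] at key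
    rw [key, ← hw]

open Classical in
/-- A harmonic function that is, on every recurrent class, the indicator of the Rabin condition is
the probability of the Rabin condition. -/
theorem harmonic_eq_rabin (G : RabinGame S A) (μ : G.ControlStrategy) (ν : G.EnvStrategy)
    {w : S → ℝ} (hw : ∀ x, w x = ∑ y, G.inducedP μ ν x y * w y)
    (hrec : ∀ r x, (∀ y, Relation.ReflTransGen (fun a b => 0 < G.inducedP μ ν a b) r y →
        Relation.ReflTransGen (fun a b => 0 < G.inducedP μ ν a b) y r) →
      Relation.ReflTransGen (fun a b => 0 < G.inducedP μ ν a b) r x →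
      w x = if (∃ y ∈ G.B, Relation.ReflTransGen (fun a b => 0 < G.inducedP μ ν a b) r y) ∧
        ¬ (∃ y ∈ G.C, Relation.ReflTransGen (fun a b => 0 < G.inducedP μ ν a b) r y)
        then 1 else 0) (s : S) :
    w s = (G.pathMeasure μ ν s).real G.rabinCondition := by
  have hlim : Tendsto (fun n => ∫ σ, w (σ n) ∂G.pathMeasure μ ν s) atTop
      (𝓝 (∫ σ, G.rabinCondition.indicator 1 σ ∂G.pathMeasure μ ν s)) := by
    refine tendsto_integral_of_dominated_convergence (fun _ => ∑ y, |w y|) (fun n => ?_)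
      (integrable_const _) (fun n => ae_of_all _ fun σ => ?_) ?_
    · exact ((Measurable.of_discrete (f := w)).comp (measurable_pi_apply n)).aestronglyMeasurable
    · exact Finset.single_le_sum (f := fun y => |w y|) (fun y _ => abs_nonneg _)
        (Finset.mem_univ _)
    -- Convergence holds because `w (σ n)` equals the indicator exactly once the path has entered
    -- its class.
    · filter_upwards [G.ae_exists_recurrent μ ν s] with σ ⟨r, hr, hio, hev⟩
      refine tendsto_const_nhds.congr' (hev.mono fun n hn => ?_)
      beta_reduce
      rw [hrec r _ hr hn, Set.indicator_apply, mem_rabinCondition]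
      simp_rw [hio]
      rfl
  rw [integral_indicator_one G.measurableSet_rabinCondition] at hlim
  simp_rw [G.integral_harmonic μ ν hw] at hlim
  exact tendsto_nhds_unique tendsto_const_nhds hlim

end RabinGame

/-! ### Bounds on the return, the Bellman equation and the limit -/

namespace RabinGame

theorem returnTerm_shift {S : Type*} (R Γ : S → ℝ) (t : ℕ) (σ : ℕ → S) :
    returnTerm R Γ t σ = returnTerm R Γ 0 (fun k => σ (t + k)) := by
  ext i
  simp [returnTerm]

theorem pathReturn_shift {S : Type*} (R Γ : S → ℝ) (t : ℕ) (σ : ℕ → S) :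
    pathReturn R Γ t σ = pathReturn R Γ 0 (fun k => σ (t + k)) := by
  rw [pathReturn, returnTerm_shift]; rfl

section Bounds

variable {S : Type*} {R Γ : S → ℝ} (hR : ∀ s, 0 ≤ R s) (hΓ : ∀ s, 0 ≤ Γ s)
  (hRΓ : ∀ s, R s ≤ 1 - Γ s) (t : ℕ) (σ : ℕ → S)

include hR hΓ in
theorem returnTerm_nonneg (i : ℕ) : 0 ≤ returnTerm R Γ t σ i :=
  mul_nonneg (hR _) (Finset.prod_nonneg fun _ _ => hΓ _)

-- The discount product acts as remaining mass: since `R ≤ 1 - Γ`, each term is at most the mass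
-- lost at that step. The induction therefore keeps the remaining product in the sum.
include hΓ hRΓ in
theorem sum_returnTerm_le (n : ℕ) : ∑ i ∈ Finset.range n, returnTerm R Γ t σ i ≤ 1 := by
  have h : ∑ i ∈ Finset.range n, returnTerm R Γ t σ i + ∏ j ∈ Finset.range n, Γ (σ (t + j)) ≤ 1 := by
    induction n with
    | zero => simp
    | succ n ih =>
      rw [Finset.sum_range_succ, Finset.prod_range_succ, returnTerm]
      have h1 : 0 ≤ ∏ j ∈ Finset.range n, Γ (σ (t + j)) := Finset.prod_nonneg fun _ _ => hΓ _
      nlinarith [mul_le_mul_of_nonneg_right (hRΓ (σ (t + n))) h1]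
  have h1 : 0 ≤ ∏ j ∈ Finset.range n, Γ (σ (t + j)) := Finset.prod_nonneg fun _ _ => hΓ _
  linarith

include hR hΓ hRΓ

theorem summable_returnTerm : Summable (returnTerm R Γ t σ) :=
  summable_of_sum_range_le (returnTerm_nonneg hR hΓ t σ) (sum_returnTerm_le hΓ hRΓ t σ)

theorem pathReturn_mem_Icc : pathReturn R Γ t σ ∈ Set.Icc (0 : ℝ) 1 :=
  ⟨tsum_nonneg (returnTerm_nonneg hR hΓ t σ),
    Real.tsum_le_of_sum_range_le (returnTerm_nonneg hR hΓ t σ) (sum_returnTerm_le hΓ hRΓ t σ)⟩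

theorem abs_pathReturn_le : |pathReturn R Γ t σ| ≤ 1 := by
  obtain ⟨h0, h1⟩ := pathReturn_mem_Icc hR hΓ hRΓ t σ
  rwa [abs_of_nonneg h0]

theorem pathReturn_zero_eq : pathReturn R Γ 0 σ =
    R (σ 0) + Γ (σ 0) * pathReturn R Γ 0 (fun k => σ (1 + k)) := by
  rw [pathReturn, (summable_returnTerm hR hΓ hRΓ 0 σ).tsum_eq_zero_add, pathReturn, ← tsum_mul_left]
  congr 1
  · simp [returnTerm]
  · refine tsum_congr fun i => ?_
    simp only [returnTerm, zero_add, Finset.prod_range_succ', add_comm 1]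
    ring

theorem measurable_pathReturn [Countable S] [MeasurableSpace S] [DiscreteMeasurableSpace S] :
    Measurable (pathReturn R Γ t) := by
  refine measurable_of_tendsto_metrizable (f := fun n σ => ∑ i ∈ Finset.range n, returnTerm R Γ t σ i)
    (fun n => ?_) (tendsto_pi_nhds.2 fun σ => (summable_returnTerm hR hΓ hRΓ t σ).hasSum.tendsto_sum_nat)
  have h : ∀ (f : S → ℝ) (k : ℕ), Measurable fun σ : ℕ → S => f (σ k) := fun f k =>
    (Measurable.of_discrete (f := f)).comp (measurable_pi_apply k)
  exact Finset.measurable_sum _ fun i _ => (h R _).mul (Finset.measurable_prod _ fun j _ => h Γ _)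

end Bounds

theorem reward_nonneg {S A : Type*} [Fintype S] (G : RabinGame S A) {γB : ℝ} (h : γB ≤ 1) (s : S) :
    0 ≤ G.reward γB s := by
  unfold reward
  split_ifs <;> linarith

theorem discount_nonneg {S A : Type*} [Fintype S] (G : RabinGame S A) {γ γB γC : ℝ} (h : 0 ≤ γ) (hB : 0 ≤ γB) (hC : 0 ≤ γC) (s : S) :
    0 ≤ G.discount γ γB γC s := by
  unfold discount
  split_ifs <;> assumption

/-- Equality holds on `B` outside `C`; on `B ∩ C` the ordering `γC ≤ γB` is what is needed. -/
theorem reward_le {S A : Type*} [Fintype S] (G : RabinGame S A) {γ γB γC : ℝ} (h : γ ≤ 1) (hC : γC ≤ γB) (hB : γB ≤ 1) (s : S) :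
    G.reward γB s ≤ 1 - G.discount γ γB γC s := by
  unfold reward discount
  split_ifs <;> linarith

variable {S A : Type*} [Fintype S] [MeasurableSpace S] [DiscreteMeasurableSpace S]
  (G : RabinGame S A) (μ : G.ControlStrategy) (ν : G.EnvStrategy)

theorem integrable_pathReturn {R Γ : S → ℝ} (hR : ∀ s, 0 ≤ R s) (hΓ : ∀ s, 0 ≤ Γ s)
    (hRΓ : ∀ s, R s ≤ 1 - Γ s) (t : ℕ) (i : S) :
    Integrable (pathReturn R Γ t) (G.pathMeasure μ ν i) :=
  Integrable.of_bound (measurable_pathReturn hR hΓ hRΓ t).aestronglyMeasurable 1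
    (ae_of_all _ fun σ => abs_pathReturn_le hR hΓ hRΓ t σ)

theorem integral_pathReturn_mem_Icc {R Γ : S → ℝ} (hR : ∀ s, 0 ≤ R s) (hΓ : ∀ s, 0 ≤ Γ s)
    (hRΓ : ∀ s, R s ≤ 1 - Γ s) (s : S) :
    ∫ σ, pathReturn R Γ 0 σ ∂G.pathMeasure μ ν s ∈ Set.Icc (0 : ℝ) 1 := by
  have h := pathReturn_mem_Icc hR hΓ hRΓ 0
  refine ⟨integral_nonneg fun σ => (h σ).1, ?_⟩
  have := integral_mono (G.integrable_pathReturn μ ν hR hΓ hRΓ 0 s) (integrable_const (1 : ℝ))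
    fun σ => (h σ).2
  simpa using this

/-- Bellman equation for the expected return. -/
theorem integral_pathReturn_eq {R Γ : S → ℝ} (hR : ∀ s, 0 ≤ R s) (hΓ : ∀ s, 0 ≤ Γ s)
    (hRΓ : ∀ s, R s ≤ 1 - Γ s) (s : S) :
    ∫ σ, pathReturn R Γ 0 σ ∂G.pathMeasure μ ν s = R s + Γ s *
      ∑ y, G.inducedP μ ν s y * ∫ σ, pathReturn R Γ 0 σ ∂G.pathMeasure μ ν y := by
  have hm := measurable_pathReturn hR hΓ hRΓ 0
  have hb := abs_pathReturn_le hR hΓ hRΓ 0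
  rw [← G.integral_shift_one μ ν s hm hb,
    integral_congr_ae (g := fun σ => R s + Γ s * pathReturn R Γ 0 (fun k => σ (1 + k)))
      ((G.pathMeasure_zero μ ν s).mono fun σ h => by
        rw [pathReturn_zero_eq hR hΓ hRΓ, h]),
    integral_add (integrable_const _), integral_const_mul]
  · simp
  · exact (Integrable.of_bound (hm.comp (by fun_prop)).aestronglyMeasurable 1
      (ae_of_all _ fun σ => hb _)).const_mul _

theorem value_eq (R Γ : S → ℝ) (hm : Measurable (pathReturn R Γ 0)) (i s : S) (t : ℕ)
    (h : G.pathMeasure μ ν i {σ | σ t = s} ≠ 0) :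
    G.value μ ν R Γ i t s = ∫ σ, pathReturn R Γ 0 σ ∂G.pathMeasure μ ν s := by
  rw [value, ← G.pathMeasure_cond μ ν i s t h,
    integral_map (Measurable.aemeasurable (by fun_prop)) hm.aestronglyMeasurable]
  exact integral_congr_ae (ae_of_all _ fun σ => pathReturn_shift R Γ t σ)

/-- The expected return converges to the probability of the Rabin condition. -/
theorem tendsto_integral_pathReturn (γB γC : ℝ → ℝ)
    (hγ : ∀ γ ∈ Set.Ioo (0 : ℝ) 1, 0 < γC γ ∧ γC γ < γB γ ∧ γB γ < γ)
    (hB : Tendsto γB (𝓝[<] 1) (𝓝 1)) (hC : Tendsto γC (𝓝[<] 1) (𝓝 1))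
    (hγB : Tendsto (fun γ => (1 - γ) / (1 - γB γ)) (𝓝[<] 1) (𝓝 0))
    (hBC : Tendsto (fun γ => (1 - γB γ) / (1 - γC γ)) (𝓝[<] 1) (𝓝 0)) (s : S) :
    Tendsto (fun γ => ∫ σ, pathReturn (G.reward (γB γ)) (G.discount γ (γB γ) (γC γ)) 0 σ
      ∂G.pathMeasure μ ν s) (𝓝[<] 1) (𝓝 ((G.pathMeasure μ ν s).real G.rabinCondition)) := by
  set v : ℝ → S → ℝ := fun γ s => ∫ σ, pathReturn (G.reward (γB γ))
    (G.discount γ (γB γ) (γC γ)) 0 σ ∂G.pathMeasure μ ν s with hvdef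
  have hIoo : ∀ᶠ γ in 𝓝[<] (1 : ℝ), γ ∈ Set.Ioo (0 : ℝ) 1 := Ioo_mem_nhdsLT zero_lt_one
  have hmem : ∀ᶠ γ in 𝓝[<] (1 : ℝ), v γ ∈ Set.Icc (0 : S → ℝ) 1 := by
    filter_upwards [hIoo] with γ h
    obtain ⟨h1, h2, h3⟩ := hγ γ h
    obtain ⟨h4, h5⟩ := h
    have key := fun s => G.integral_pathReturn_mem_Icc μ ν (G.reward_nonneg (by linarith))
      (G.discount_nonneg h4.le (by linarith) h1.le) (G.reward_le h5.le h2.le (by linarith)) s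
    exact ⟨fun s => (key s).1, fun s => (key s).2⟩
  have hbell : ∀ᶠ γ in 𝓝[<] (1 : ℝ), ∀ x, v γ x = G.reward (γB γ) x +
      G.discount γ (γB γ) (γC γ) x * ∑ y, G.inducedP μ ν x y * v γ y := by
    filter_upwards [hIoo] with γ h
    obtain ⟨h1, h2, h3⟩ := hγ γ h
    obtain ⟨h4, h5⟩ := h
    exact fun s => G.integral_pathReturn_eq μ ν (G.reward_nonneg (by linarith))
      (G.discount_nonneg h4.le (by linarith) h1.le) (G.reward_le h5.le h2.le (by linarith)) s
  -- Passing to ultrafilters supplies a limit `w` by compactness, so convergence of `v` need not be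
  -- known beforehand.
  refine tendsto_iff_ultrafilter _ _ _ |>.2 fun g hg => ?_
  obtain ⟨w, -, hw⟩ := isCompact_Icc.ultrafilter_le_nhds (g.map v)
    (le_principal_iff.2 (hmem.filter_mono hg))
  have hw' : ∀ x, Tendsto (fun γ => v γ x) g (𝓝 (w x)) := tendsto_pi_nhds.1 hw
  have h1 : Tendsto (fun γ : ℝ => γ) g (𝓝 1) := hg.trans nhdsWithin_le_nhds
  have hharm : ∀ x, w x = ∑ y, G.inducedP μ ν x y * w y := fun x => by
    have h2 : Tendsto (fun γ => G.reward (γB γ) x +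
        G.discount γ (γB γ) (γC γ) x * ∑ y, G.inducedP μ ν x y * v γ y) g
        (𝓝 (0 + 1 * ∑ y, G.inducedP μ ν x y * w y)) := by
      refine Tendsto.add ?_ (Tendsto.mul ?_ (tendsto_finsetSum _ fun y _ => (hw' y).const_mul _))
      · unfold reward
        split_ifs
        · simpa using (hB.mono_left hg).const_sub 1
        · exact tendsto_const_nhds
      · unfold discount
        split_ifs
        exacts [hC.mono_left hg, hB.mono_left hg, h1]
    rw [zero_add, one_mul] at h2
    exact tendsto_nhds_unique (hw' x) (h2.congr' ((hbell.filter_mono hg).mono fun γ h => (h x).symm))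
  rw [← G.harmonic_eq_rabin μ ν hharm (fun r x hr hx => FiniteChain.limit_of_recurrent
    (G.inducedP_nonneg μ ν) (G.inducedP_sum μ ν) hr G.B G.C
    ((hIoo.filter_mono hg).mono fun γ h => ⟨(hγ γ h).2.1, (hγ γ h).2.2, h.2⟩) h1 (hB.mono_left hg)
    (hC.mono_left hg) (hγB.mono_left hg) (hBC.mono_left hg)
    ((hmem.filter_mono hg).mono fun γ h => h.1) (hbell.filter_mono hg) hw' hx) s]
  exact hw' s

end RabinGame

theorem theorem1 {S A : Type*} [Fintype S] [Finite A] [MeasurableSpace S]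
    [DiscreteMeasurableSpace S] (G : RabinGame S A)
    (μ : G.ControlStrategy) (ν : G.EnvStrategy) (γB γC : ℝ → ℝ)
    (hγ : ∀ γ ∈ Set.Ioo (0 : ℝ) 1, 0 < γC γ ∧ γC γ < γB γ ∧ γB γ < γ)
    (hB : Tendsto γB (𝓝[<] 1) (𝓝 1)) (hC : Tendsto γC (𝓝[<] 1) (𝓝 1))
    (hγB : Tendsto (fun γ => (1 - γ) / (1 - γB γ)) (𝓝[<] 1) (𝓝 0))
    (hBC : Tendsto (fun γ => (1 - γB γ) / (1 - γC γ)) (𝓝[<] 1) (𝓝 0)) :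
    (∀ γ ∈ Set.Ioo (0 : ℝ) 1, ∀ t : ℕ,
      (∀ σ : ℕ → S,
        Summable (RabinGame.returnTerm (G.reward (γB γ)) (G.discount γ (γB γ) (γC γ)) t σ)) ∧
      ∀ i : S, Integrable
        (RabinGame.pathReturn (G.reward (γB γ)) (G.discount γ (γB γ) (γC γ)) t)
        (G.pathMeasure μ ν i)) ∧
    MeasurableSet G.rabinCondition ∧
    ∀ s : S,
      Tendsto
        (fun γ => ∫ σ, RabinGame.pathReturn (G.reward (γB γ))
          (G.discount γ (γB γ) (γC γ)) 0 σ ∂(G.pathMeasure μ ν s))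
        (𝓝[<] 1) (𝓝 ((G.pathMeasure μ ν s).real G.rabinCondition)) ∧
      ∀ (i : S) (t : ℕ), G.pathMeasure μ ν i {σ | σ t = s} ≠ 0 →
        Tendsto
          (fun γ => G.value μ ν (G.reward (γB γ)) (G.discount γ (γB γ) (γC γ)) i t s)
          (𝓝[<] 1) (𝓝 ((G.pathMeasure μ ν s).real G.rabinCondition)) := by
  refine ⟨fun γ h t => ?_, G.measurableSet_rabinCondition, fun s => ⟨?_, fun i t hit => ?_⟩⟩
  · obtain ⟨h1, h2, h3⟩ := hγ γ h
    obtain ⟨h4, h5⟩ := h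
    have hR := G.reward_nonneg (γB := γB γ) (by linarith)
    have hΓ := G.discount_nonneg (γB := γB γ) h4.le (by linarith) h1.le
    have hRΓ := G.reward_le h5.le h2.le (by linarith)
    exact ⟨RabinGame.summable_returnTerm hR hΓ hRΓ t, G.integrable_pathReturn μ ν hR hΓ hRΓ t⟩
  · exact G.tendsto_integral_pathReturn μ ν γB γC hγ hB hC hγB hBC s
  -- The conditional value is identified with the integral for `γ` in `(0,1)`, where the return is
  -- known to be measurable; this suffices near `1` from the left.
  · refine (G.tendsto_integral_pathReturn μ ν γB γC hγ hB hC hγB hBC s).congr' ?_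
    filter_upwards [Ioo_mem_nhdsLT (zero_lt_one (α := ℝ))] with γ h
    obtain ⟨h1, h2, h3⟩ := hγ γ h
    obtain ⟨h4, h5⟩ := h
    exact (G.value_eq μ ν _ _ (RabinGame.measurable_pathReturn (G.reward_nonneg (by linarith))
      (G.discount_nonneg h4.le (by linarith) h1.le) (G.reward_le h5.le h2.le (by linarith)) 0)
      i s t hit).symm
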